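/- Let $(R,\mathfrak m)$ be a commutative Noetherian local ring that is complete (and separated) in its $\mathfrak m$-adic topology, and let $M$ be a finitely generated $R$-module. Suppose that $M$ has small cofinite irreducibles, that is, for every $n\in\mathbb N$ there is an irreducible submodule $Q$ of $M$ (a proper submodule that is not the intersection of two strictly larger submodules) such that $Q\subseteq\mathfrak m^nM$ and $M/Q$ is Artinian. Then $M$ is cyclically pure injective (CP-injective): for every exact sequence $0\to A\to B\to C\to 0$ of $R$-modules that is cyclically pure, i.e. for which $R/\mathfrak a\otimes_R A\to R/\mathfrak a\otimes_R B$ is injective for every finitely generated ideal $\mathfrak a$ of $R$, the induced sequence $$0\to\operatorname{Hom}_R(C,M)\to\operatorname{Hom}_R(B,M)\to\operatorname{Hom}_R(A,M)\to 0$$ is exact. -/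

import Mathlib

universe u v w x

/-- The sequence `0 → A --f--> B --g--> C → 0` of `R`-modules is exact and cyclically pure:
`R ⧸ a ⊗ A → R ⧸ a ⊗ B` is injective for every finitely generated ideal `a` of `R`. -/
structure IsCyclicallyPureExact {R : Type u} [CommRing R]
    {A : Type v} {B : Type w} {C : Type x}
    [AddCommGroup A] [Module R A] [AddCommGroup B] [Module R B] [AddCommGroup C] [Module R C]
    (f : A →ₗ[R] B) (g : B →ₗ[R] C) : Prop where
  injective : Function.Injective f
  exact : Function.Exact f g
  surjective : Function.Surjective g
  lTensor_injective : ∀ a : Ideal R, a.FG → Function.Injective (LinearMap.lTensor (R ⧸ a) f)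

/-- `D` is cyclically pure injective (tested against modules in the universe `w`): for every
cyclically pure exact sequence `0 → A → B → C → 0`, the induced sequence
`0 → Hom(C, D) → Hom(B, D) → Hom(A, D) → 0` is exact. -/
def IsCPInjective (R : Type u) [CommRing R] (D : Type v) [AddCommGroup D] [Module R D] : Prop :=
  ∀ (A B C : Type w) [AddCommGroup A] [Module R A] [AddCommGroup B] [Module R B]
    [AddCommGroup C] [Module R C] (f : A →ₗ[R] B) (g : B →ₗ[R] C),
    IsCyclicallyPureExact f g →
      Function.Injective (LinearMap.lcomp R D g) ∧
      Function.Exact (LinearMap.lcomp R D g) (LinearMap.lcomp R D f) ∧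
      Function.Surjective (LinearMap.lcomp R D f)

/-- `M` has small cofinite irreducibles: for every `n` there is an irreducible submodule `Q`
(proper, and not an intersection of two strictly larger submodules) with `Q ⊆ 𝔪 ^ n M` and
`M ⧸ Q` Artinian. -/
def HasSmallCofiniteIrreducibles (R : Type u) [CommRing R] [IsLocalRing R]
    (M : Type v) [AddCommGroup M] [Module R M] : Prop :=
  ∀ n : ℕ, ∃ Q : Submodule R M, InfIrred Q ∧
    Q ≤ IsLocalRing.maximalIdeal R ^ n • (⊤ : Submodule R M) ∧ IsArtinian R (M ⧸ Q)

/-! If `Q` is irreducible and cofinite, `M ⧸ Q` has finite length and, by a length count, is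
injective over `R` modulo its annihilator (`Module.Baer.of_faithful_of_infIrred_bot`). Cyclic purity
at that annihilator therefore extends maps into `M ⧸ Q` from `A` to `B`. Extensions for different
`Q` need not agree; linear compactness of products of Artinian modules selects a compatible family.
The `Q` form a neighbourhood basis of zero in the complete module `M`, so the family glues to a map
`B → M`. -/

/-! ### Length and self-injectivity -/

section Length

variable {R : Type*} [CommRing R] {N : Type*} [AddCommGroup N] [Module R N]

/-- If the zero submodule of `N` is irreducible, then the homomorphisms from a simple module to `N`
form a module of length at most one. -/
theorem Module.length_linearMap_le_one_of_infIrred_bot (hN : InfIrred (⊥ : Submodule R N))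
    (X : Type*) [AddCommGroup X] [Module R X] [IsSimpleModule R X] :
    Module.length R (X →ₗ[R] N) ≤ 1 := by
  rcases subsingleton_or_nontrivial (X →ₗ[R] N) with h | h
  · simp
  refine (Module.length_eq_one_iff.mpr ?_).le
  refine isSimpleModule_iff_toSpanSingleton_surjective.mpr ⟨h, fun f hf g ↦ ?_⟩
  by_cases hg : g = 0
  · exact ⟨0, by simp [hg]⟩
  -- The images of two nonzero maps meet nontrivially. A common value `f a = g b` with `a = r • b`
  -- gives `g = r • f` on the generator `b`.
  have hne : LinearMap.range f ⊓ LinearMap.range g ≠ ⊥ := fun h0 ↦ by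
    rcases hN.2 h0 with h1 | h1
    · exact hf (LinearMap.range_eq_bot.mp h1)
    · exact hg (LinearMap.range_eq_bot.mp h1)
  obtain ⟨_, ⟨⟨a, rfl⟩, ⟨b, hb⟩⟩, hz⟩ := Submodule.exists_mem_ne_zero_of_ne_bot hne
  have hb0 : b ≠ 0 := by
    rintro rfl
    exact hz (by rw [← hb, map_zero])
  obtain ⟨r, hr⟩ := IsSimpleModule.toSpanSingleton_surjective R hb0 a
  refine ⟨r, LinearMap.ext fun y ↦ ?_⟩
  obtain ⟨s, rfl⟩ := IsSimpleModule.toSpanSingleton_surjective R hb0 y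
  simp only [LinearMap.toSpanSingleton_apply] at hr
  simp only [LinearMap.toSpanSingleton_apply, LinearMap.smul_apply, map_smul]
  rw [← hr, map_smul] at hb
  rw [hb, smul_comm, ← map_smul f s]

/-- If the zero submodule of `N` is irreducible, then dualizing into `N` does not increase
the length. -/
theorem IsFiniteLength.length_linearMap_le (hN : InfIrred (⊥ : Submodule R N))
    {X : Type*} [AddCommGroup X] [Module R X] (hX : IsFiniteLength R X) :
    Module.length R (X →ₗ[R] N) ≤ Module.length R X := by
  induction hX with
  | of_subsingleton => simp
  | @of_simple_quotient X _ _ P _ _ ih =>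
    have h1 := Module.length_eq_add_of_exact P.subtype P.mkQ P.subtype_injective
      P.mkQ_surjective (LinearMap.exact_subtype_mkQ P)
    -- Restriction to `P` need not be surjective, so its image replaces `Hom(P, N)`; only an upper
    -- bound is needed.
    have h2 := Module.length_eq_add_of_exact (LinearMap.lcomp R N P.mkQ)
      (LinearMap.lcomp R N P.subtype).rangeRestrict
      (LinearMap.lcomp_injective_of_surjective _ P.mkQ_surjective)
      (LinearMap.surjective_rangeRestrict _) (fun f ↦ by
        rw [← LinearMap.exact_lcomp_of_exact_of_surjective N (LinearMap.exact_subtype_mkQ P)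
          P.mkQ_surjective f, Subtype.ext_iff]
        rfl)
    rw [h1, h2, add_comm]
    gcongr
    · exact (Module.length_le_of_injective _ (Submodule.subtype_injective _)).trans ih
    · exact (Module.length_linearMap_le_one_of_infIrred_bot hN _).trans
        (Module.length_eq_one R _).ge

/-- A faithful module of finite length whose zero submodule is irreducible is injective. -/
theorem Module.Baer.of_faithful_of_infIrred_bot (hN : InfIrred (⊥ : Submodule R N))
    (hfin : IsFiniteLength R N) (hfaith : ∀ r : R, (∀ n : N, r • n = 0) → r = 0) :
    Module.Baer R N := by
  intro I g
  -- With `K = ker φ`, faithfulness embeds `I` in `Hom(N/K, N)`. Hence `ℓ(I) ≤ ℓ(N/K) = ℓ(range φ) ≤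
  -- ℓ(Hom(I, N)) ≤ ℓ(I)`, all finite, and `φ` is onto: every map `I → N` is evaluation at some `n`.
  let φ : N →ₗ[R] (I →ₗ[R] N) := (LinearMap.lsmul R N).flip.compl₂ I.subtype
  have hφ (n : N) (x : I) : φ n x = (x : R) • n := rfl
  let ψ : I →ₗ[R] ((N ⧸ LinearMap.ker φ) →ₗ[R] N) :=
    (((LinearMap.range φ).subtype ∘ₗ φ.quotKerEquivRange.toLinearMap)).flip
  have hψ (x : I) (n : N) : ψ x (Submodule.Quotient.mk n) = (x : R) • n := rfl
  have hψi : Function.Injective ψ := by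
    refine (injective_iff_map_eq_zero _).mpr fun x hx ↦ Subtype.ext (hfaith _ fun n ↦ ?_)
    rw [← hψ, hx, LinearMap.zero_apply]
  have hK : IsFiniteLength R (N ⧸ LinearMap.ker φ) :=
    hfin.of_surjective (Submodule.mkQ_surjective _)
  have h1 : Module.length R I ≤ Module.length R (LinearMap.range φ) :=
    (Module.length_le_of_injective ψ hψi).trans
      ((hK.length_linearMap_le hN).trans φ.quotKerEquivRange.length_eq.le)
  have hI : IsFiniteLength R I :=
    Module.length_ne_top_iff.mp (ne_top_of_le_ne_top
      (Module.length_ne_top_iff.mpr (hK.of_surjective φ.quotKerEquivRange.surjective)) h1)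
  have h2 := hI.length_linearMap_le hN
  have hH : IsFiniteLength R (I →ₗ[R] N) :=
    Module.length_ne_top_iff.mp (ne_top_of_le_ne_top (Module.length_ne_top_iff.mpr hI) h2)
  obtain ⟨_, _⟩ := isFiniteLength_iff_isNoetherian_isArtinian.mp hH
  have htop : LinearMap.range φ = ⊤ := by
    by_contra hne
    exact ((Submodule.length_lt hne).trans_le (h2.trans h1)).false
  obtain ⟨n, hn⟩ := LinearMap.range_eq_top.mp htop g
  exact ⟨LinearMap.toSpanSingleton R N n, fun x hx ↦ by rw [← hn, hφ]; rfl⟩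

end Length

/-! ### Linear compactness -/

section LinearlyCompact

variable {R : Type*} [CommRing R]

/-- The affine subspace of solutions of the linear equation `L y = c`. -/
def LinearMap.affineFiber {E V : Type*} [AddCommGroup E] [Module R E] [AddCommGroup V] [Module R V]
    (L : E →ₗ[R] V) (c : V) : AffineSubspace R E where
  carrier := {y | L y = c}
  smul_vsub_vadd_mem' r x y z hx hy hz := by
    simp only [Set.mem_ofPred_eq] at *
    simp [hx, hy, hz]

@[simp]
theorem LinearMap.mem_affineFiber {E V : Type*} [AddCommGroup E] [Module R E] [AddCommGroup V]
    [Module R V] (L : E →ₗ[R] V) (c : V) (y : E) : y ∈ L.affineFiber c ↔ L y = c :=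
  Iff.rfl

/-- Linear compactness of products of Artinian modules: a family of affine subspaces with the
finite intersection property, each depending on finitely many coordinates, has a common point. -/
theorem exists_forall_mem_affineSubspace_of_finite {ι : Type*} {X : ι → Type*}
    [∀ i, AddCommGroup (X i)] [∀ i, Module R (X i)] [∀ i, IsArtinian R (X i)]
    (S : Set (AffineSubspace R (Π i, X i)))
    (hS : ∀ W ∈ S, ∃ s : Finset ι, ∀ y z : Π i, X i, (∀ i ∈ s, y i = z i) → y ∈ W → z ∈ W)
    (hfip : ∀ t : Set (AffineSubspace R (Π i, X i)), t.Finite → t ⊆ S → ∃ y, ∀ W ∈ t, y ∈ W) :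
    ∃ y, ∀ W ∈ S, y ∈ W := by
  classical
  let FIP : Set (Set (AffineSubspace R (Π i, X i))) :=
    {F | ∀ t : Set (AffineSubspace R (Π i, X i)), t.Finite → t ⊆ F → ∃ y, ∀ W ∈ t, y ∈ W}
  obtain ⟨F, hSF, hF⟩ := zorn_subset_nonempty FIP (by
    intro c hc hchain hne
    refine ⟨⋃₀ c, fun t ht htc ↦ ?_, fun s hs ↦ Set.subset_sUnion_of_mem hs⟩
    obtain ⟨s, hs, hts⟩ := DirectedOn.exists_mem_subset_of_finite_of_subset_sUnion hne
      hchain.directedOn ht htc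
    exact hc hs t ht hts) S hfip
  -- Maximality of `F`: it contains every `W` that meets all its finite intersections.
  have hmem (W : AffineSubspace R (Π i, X i))
      (hW : ∀ t, t.Finite → t ⊆ F → ∃ y ∈ W, ∀ V ∈ t, y ∈ V) : W ∈ F := by
    have hins : insert W F ∈ FIP := by
      intro t ht htF
      obtain ⟨y, hy, hyt⟩ := hW (t \ {W}) ht.sdiff (by
        intro V hV
        exact (htF hV.1).resolve_left hV.2)
      refine ⟨y, fun V hV ↦ ?_⟩
      by_cases h : V = W
      · exact h ▸ hy
      · exact hyt V ⟨hV, h⟩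
    exact hF.le_of_ge hins (Set.subset_insert _ _) (Set.mem_insert _ _)
  have key (i : ι) : ∃ x : X i, (LinearMap.proj i : (Π i, X i) →ₗ[R] X i).affineFiber x ∈ F := by
    let p : (Π i, X i) →ᵃ[R] X i := (LinearMap.proj i : (Π i, X i) →ₗ[R] X i).toAffineMap
    -- Choose a finite intersection whose projection to `X i` has minimal direction. Further members
    -- of `F` cannot shrink this projection, so each of its points is the `i`-th coordinate of a
    -- point in every finite intersection.
    let D : Set (Submodule R (X i)) :=
      {P | ∃ t, t.Finite ∧ t ⊆ F ∧ ((sInf t).map p).direction = P}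
    obtain ⟨_, ⟨t₀, ht₀, ht₀F, rfl⟩, hmin⟩ := WellFounded.has_min
      (wellFounded_lt (α := Submodule R (X i))) D ⟨_, ∅, Set.finite_empty, by simp, rfl⟩
    obtain ⟨y₀, hy₀⟩ := hF.prop t₀ ht₀ ht₀F
    refine ⟨y₀ i, hmem _ fun t ht htF ↦ ?_⟩
    have hle : (sInf (t ∪ t₀)).map p ≤ (sInf t₀).map p :=
      AffineSubspace.map_mono _ (sInf_le_sInf Set.subset_union_right)
    obtain ⟨y₁, hy₁⟩ := hF.prop (t ∪ t₀) (ht.union ht₀) (Set.union_subset htF ht₀F)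
    have heq : (sInf (t ∪ t₀)).map p = (sInf t₀).map p := by
      refine AffineSubspace.eq_of_direction_eq_of_nonempty_of_le ?_ ?_ hle
      · refine (AffineSubspace.direction_le hle).eq_of_not_lt (hmin _
          ⟨_, ht.union ht₀, Set.union_subset htF ht₀F, rfl⟩)
      · exact ⟨p y₁, AffineSubspace.mem_map_of_mem _ (by
          simpa [AffineSubspace.mem_sInf_iff] using hy₁)⟩
    have hm : p y₀ ∈ (sInf (t ∪ t₀)).map p := by
      rw [heq]
      exact AffineSubspace.mem_map_of_mem _ (by
          simpa [AffineSubspace.mem_sInf_iff] using hy₀)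
    obtain ⟨y, hy, hyp⟩ := AffineSubspace.mem_map.mp hm
    exact ⟨y, hyp, fun V hV ↦ (AffineSubspace.mem_sInf_iff _ _).mp hy V (Or.inl hV)⟩
  choose x hx using key
  refine ⟨x, fun W hW ↦ ?_⟩
  obtain ⟨s, hs⟩ := hS W hW
  obtain ⟨y, hy⟩ := hF.prop
    (insert W ((fun i ↦ (LinearMap.proj i : (Π i, X i) →ₗ[R] X i).affineFiber (x i)) '' s))
    ((s.finite_toSet.image _).insert _) (by
      refine Set.insert_subset (hSF hW) ?_
      rintro _ ⟨i, -, rfl⟩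
      exact hx i)
  refine hs y x (fun i hi ↦ ?_) (hy W (Set.mem_insert _ _))
  exact hy _ (Set.mem_insert_of_mem _ ⟨i, hi, rfl⟩)

end LinearlyCompact
open TensorProduct

/-! ### Extension into irreducible quotients -/

section ResidualExtension

variable {R : Type*} [CommRing R]

/-- A module of finite length with irreducible zero submodule has the extension property for maps
which are injective modulo its annihilator. -/
theorem exists_comp_eq_of_infIrred_bot {N A B : Type*} [AddCommGroup N] [Module R N]
    [AddCommGroup A] [Module R A] [AddCommGroup B] [Module R B]
    (hN : InfIrred (⊥ : Submodule R N)) [IsNoetherian R N] [IsArtinian R N] (f : A →ₗ[R] B)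
    (hf : Function.Injective (f.lTensor (R ⧸ Module.annihilator R N))) (g : A →ₗ[R] N) :
    ∃ h : B →ₗ[R] N, h ∘ₗ f = g := by
  let S := R ⧸ Module.annihilator R N
  let _ : Module S N := Module.quotientAnnihilator
  have hsmul (r : R) (n : N) : (Ideal.Quotient.mk (Module.annihilator R N) r : S) • n = r • n := rfl
  have : IsScalarTower R S N := IsScalarTower.of_algebraMap_smul fun r n ↦ hsmul r n
  have hbot : InfIrred (⊥ : Submodule S N) := by
    refine ⟨fun h ↦ hN.1 ?_, fun P Q hPQ ↦ ?_⟩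
    · rw [isMax_iff_eq_top] at h ⊢
      simpa using congrArg (Submodule.restrictScalars R) h
    · have := @hN.2 (P.restrictScalars R) (Q.restrictScalars R) (by
        simpa using congrArg (Submodule.restrictScalars R) hPQ)
      simpa using this
  have hfin : IsFiniteLength S N := isFiniteLength_iff_isNoetherian_isArtinian.mpr
    ⟨isNoetherian_of_tower R inferInstance, isArtinian_of_tower R inferInstance⟩
  have hbaer : Module.Baer S N := by
    refine Module.Baer.of_faithful_of_infIrred_bot hbot hfin fun s hs ↦ ?_
    obtain ⟨r, rfl⟩ := Ideal.Quotient.mk_surjective s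
    exact Ideal.Quotient.eq_zero_iff_mem.mpr (Module.mem_annihilator.mpr hs)
  -- Maps to `N` factor through base change to `S`, where `f` is injective by `hf`; the extension is
  -- then restricted along `b ↦ 1 ⊗ b`.
  obtain ⟨h, hh⟩ := hbaer.extension_property (f.baseChange S) hf (g.liftBaseChange S)
  refine ⟨h.restrictScalars R ∘ₗ TensorProduct.mk R S B 1, LinearMap.ext fun a ↦ ?_⟩
  simpa using LinearMap.congr_fun hh (1 ⊗ₜ[R] a)

theorem Submodule.infIrred_bot_quotient {M : Type*} [AddCommGroup M] [Module R M]
    {Q : Submodule R M} (hQ : InfIrred Q) : InfIrred (⊥ : Submodule R (M ⧸ Q)) := by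
  refine ⟨fun h ↦ hQ.1 ?_, fun P P' hP ↦ ?_⟩
  · rw [isMax_iff_eq_top] at h ⊢
    simpa using congrArg (Submodule.comap Q.mkQ) h
  · have := @hQ.2 (P.comap Q.mkQ) (P'.comap Q.mkQ) (by
      rw [← Submodule.comap_inf, hP]; simp)
    refine this.imp (fun h ↦ ?_) (fun h ↦ ?_) <;>
    · have := congrArg (Submodule.map Q.mkQ) h
      rwa [Submodule.map_comap_eq_of_surjective Q.mkQ_surjective, Submodule.mkQ_map_self] at this

end ResidualExtension

/-! ### Completeness and cofinite submodules -/

section Completeness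

/-- A finite module over a precomplete ring is precomplete. -/
theorem IsPrecomplete.of_module_finite {R : Type*} [CommRing R] (I : Ideal R) [IsPrecomplete I R]
    (M : Type*) [AddCommGroup M] [Module R M] [Module.Finite R M] : IsPrecomplete I M := by
  refine AdicCompletion.of_surjective_iff.mp fun y ↦ ?_
  obtain ⟨t, rfl⟩ := AdicCompletion.ofTensorProduct_surjective_of_finite I M y
  induction t with
  | zero => exact ⟨0, by simp⟩
  | add s t hs ht =>
    obtain ⟨a, ha⟩ := hs
    obtain ⟨b, hb⟩ := ht
    exact ⟨a + b, by rw [map_add, map_add, ha, hb]⟩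
  | tmul r m =>
    obtain ⟨r, rfl⟩ := AdicCompletion.of_surjective I R r
    refine ⟨r • m, ?_⟩
    rw [AdicCompletion.ofTensorProduct_tmul, map_smul]
    ext n
    rfl

/-- A cofinite submodule of a finite module over a local ring contains a power of the
maximal ideal. -/
theorem Submodule.exists_maximalIdeal_pow_smul_top_le {R : Type*} [CommRing R] [IsLocalRing R]
    {M : Type*} [AddCommGroup M] [Module R M] [IsNoetherian R M] (Q : Submodule R M)
    [IsArtinian R (M ⧸ Q)] :
    ∃ n : ℕ, IsLocalRing.maximalIdeal R ^ n • (⊤ : Submodule R M) ≤ Q := by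
  let 𝔪 := IsLocalRing.maximalIdeal R
  let F : ℕ →o (Submodule R (M ⧸ Q))ᵒᵈ :=
    ⟨fun n ↦ OrderDual.toDual (𝔪 ^ n • (⊤ : Submodule R (M ⧸ Q))), fun m n hmn ↦
      Submodule.smul_mono_left (Ideal.pow_le_pow_right hmn)⟩
  obtain ⟨n, hn⟩ := IsArtinian.monotone_stabilizes F
  have heq : 𝔪 ^ n • (⊤ : Submodule R (M ⧸ Q)) = 𝔪 ^ (n + 1) • ⊤ := hn (n + 1) n.le_succ
  -- Nakayama: the stable term equals `𝔪` times itself.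
  have hzero : 𝔪 ^ n • (⊤ : Submodule R (M ⧸ Q)) = ⊥ := by
    refine Submodule.eq_bot_of_le_smul_of_le_jacobson_bot 𝔪 _ (IsNoetherian.noetherian _) ?_
      (IsLocalRing.maximalIdeal_le_jacobson _)
    rw [← Submodule.mul_smul, ← pow_succ']
    exact heq.le
  refine ⟨n, ?_⟩
  rw [← Q.ker_mkQ, ← Submodule.comap_bot, ← Submodule.map_le_iff_le_comap, Submodule.map_smul'',
    Submodule.map_top, Q.range_mkQ]
  exact hzero.le

end Completeness

/-! ### Gluing the extensions -/

section Gluing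

variable {R : Type*} [CommRing R] {M : Type*} [AddCommGroup M] [Module R M]

/-- Extensions modulo each member of a filtered family of cofinite submodules can be
chosen compatibly. -/
theorem exists_compatible_family_of_exists_extension {A B J : Type*} [AddCommGroup A] [Module R A]
    [AddCommGroup B] [Module R B] [Nonempty J] (Q : J → Submodule R M)
    [∀ j, IsArtinian R (M ⧸ Q j)] (hQ : Directed (· ≥ ·) Q) (f : A →ₗ[R] B) (φ : A →ₗ[R] M)
    (hext : ∀ j, ∃ h : B →ₗ[R] M ⧸ Q j, h ∘ₗ f = (Q j).mkQ ∘ₗ φ) :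
    ∃ h : ∀ j, B →ₗ[R] M ⧸ Q j, (∀ j, h j ∘ₗ f = (Q j).mkQ ∘ₗ φ) ∧
      ∀ i j (hij : Q i ≤ Q j), Submodule.factor hij ∘ₗ h i = h j := by
  classical
  -- The unknowns are the values `h j b`. Additivity, homogeneity, extension and compatibility are
  -- affine equations, each in at most three of them.
  let E := Π p : B × J, M ⧸ Q p.2
  let π (b : B) (j : J) : E →ₗ[R] M ⧸ Q j := LinearMap.proj (b, j)
  have hπ (b : B) (j : J) (y : E) : π b j y = y (b, j) := rfl
  let eqAdd (p : B × B × J) : AffineSubspace R E :=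
    (π (p.1 + p.2.1) p.2.2 - π p.1 p.2.2 - π p.2.1 p.2.2).affineFiber 0
  let eqSMul (p : R × B × J) : AffineSubspace R E :=
    (π (p.1 • p.2.1) p.2.2 - p.1 • π p.2.1 p.2.2).affineFiber 0
  let eqExt (p : A × J) : AffineSubspace R E :=
    (π (f p.1) p.2).affineFiber ((Q p.2).mkQ (φ p.1))
  let eqCompat (p : B × {q : J × J // Q q.1 ≤ Q q.2}) : AffineSubspace R E :=
    (Submodule.factor p.2.2 ∘ₗ π p.1 p.2.1.1 - π p.1 p.2.1.2).affineFiber 0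
  have hfin : ∀ W ∈ Set.range eqAdd ∪ Set.range eqSMul ∪ Set.range eqExt ∪ Set.range eqCompat,
      ∃ s : Finset (B × J), ∀ y z : E, (∀ i ∈ s, y i = z i) → y ∈ W → z ∈ W := by
    rintro W (((⟨⟨b, b', j⟩, rfl⟩ | ⟨⟨r, b, j⟩, rfl⟩) | ⟨⟨a, j⟩, rfl⟩) | ⟨⟨b, ⟨i, j⟩, hij⟩, rfl⟩)
    · refine ⟨{(b + b', j), (b, j), (b', j)}, fun y z hyz ↦ ?_⟩
      simp only [Finset.mem_insert, Finset.mem_singleton, forall_eq_or_imp, forall_eq] at hyz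
      simp [eqAdd, hπ, hyz]
    · refine ⟨{(r • b, j), (b, j)}, fun y z hyz ↦ ?_⟩
      simp only [Finset.mem_insert, Finset.mem_singleton, forall_eq_or_imp, forall_eq] at hyz
      simp [eqSMul, hπ, hyz]
    · refine ⟨{(f a, j)}, fun y z hyz ↦ ?_⟩
      simp only [Finset.mem_singleton, forall_eq] at hyz
      simp [eqExt, hπ, hyz]
    · refine ⟨{(b, i), (b, j)}, fun y z hyz ↦ ?_⟩
      simp only [Finset.mem_insert, Finset.mem_singleton, forall_eq_or_imp, forall_eq] at hyz
      simp [eqCompat, hπ, hyz]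
  have hsolve (k : J) : ∃ y : E,
      (∀ p, Q k ≤ Q p.2.2 → y ∈ eqAdd p) ∧ (∀ p, Q k ≤ Q p.2.2 → y ∈ eqSMul p) ∧
      (∀ p, Q k ≤ Q p.2 → y ∈ eqExt p) ∧ (∀ p, Q k ≤ Q p.2.1.1 → y ∈ eqCompat p) := by
    obtain ⟨h, hh⟩ := hext k
    -- One extension at level `k`, pushed forward, solves every equation at levels above `Q k`. The
    -- value `0` elsewhere is arbitrary, since those coordinates occur in none of these equations.
    let y : E := fun p ↦ if hp : Q k ≤ Q p.2 then Submodule.factor hp (h p.1) else 0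
    have hy (b : B) (j : J) (hj : Q k ≤ Q j) : y (b, j) = Submodule.factor hj (h b) := dif_pos hj
    refine ⟨y, ?_, ?_, ?_, ?_⟩
    · rintro ⟨b, b', j⟩ hj
      simp [eqAdd, hπ, hy _ _ hj]
    · rintro ⟨r, b, j⟩ hj
      simp [eqSMul, hπ, hy _ _ hj]
    · rintro ⟨a, j⟩ hj
      have := LinearMap.congr_fun hh a
      simp only [LinearMap.comp_apply] at this
      simp [eqExt, hπ, hy _ _ hj, this]
    · rintro ⟨b, ⟨i, j⟩, hij⟩ hi
      simp [eqCompat, hπ, hy _ _ hi, hy _ _ (hi.trans hij)]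
  have hlow : ∀ W ∈ Set.range eqAdd ∪ Set.range eqSMul ∪ Set.range eqExt ∪ Set.range eqCompat,
      ∃ i : J, ∀ k, Q k ≤ Q i → ∀ y : E, ((∀ p, Q k ≤ Q p.2.2 → y ∈ eqAdd p) ∧
        (∀ p, Q k ≤ Q p.2.2 → y ∈ eqSMul p) ∧ (∀ p, Q k ≤ Q p.2 → y ∈ eqExt p) ∧
        (∀ p, Q k ≤ Q p.2.1.1 → y ∈ eqCompat p)) → y ∈ W := by
    rintro W (((⟨p, rfl⟩ | ⟨p, rfl⟩) | ⟨p, rfl⟩) | ⟨p, rfl⟩)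
    · exact ⟨_, fun k hk y hy ↦ hy.1 p hk⟩
    · exact ⟨_, fun k hk y hy ↦ hy.2.1 p hk⟩
    · exact ⟨_, fun k hk y hy ↦ hy.2.2.1 p hk⟩
    · exact ⟨_, fun k hk y hy ↦ hy.2.2.2 p hk⟩
  obtain ⟨y, hy⟩ := exists_forall_mem_affineSubspace_of_finite _ hfin (by
    intro t ht hts
    choose! i hi using hlow
    -- Finitely many equations involve finitely many levels, so a single `k` lies below them all.
    obtain ⟨k, hk⟩ := hQ.finset_le (ht.toFinset.image i)
    obtain ⟨y, hy⟩ := hsolve k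
    exact ⟨y, fun W hW ↦ hi W (hts hW) k
      (hk _ (Finset.mem_image_of_mem _ (ht.mem_toFinset.mpr hW))) y hy⟩)
  have hadd (b b' : B) (j : J) : y (b + b', j) = y (b, j) + y (b', j) := by
    have := hy _ (Or.inl (Or.inl (Or.inl ⟨(b, b', j), rfl⟩)))
    simp only [eqAdd, LinearMap.mem_affineFiber, LinearMap.sub_apply, hπ, sub_sub] at this
    exact sub_eq_zero.mp this
  have hsmul (r : R) (b : B) (j : J) : y (r • b, j) = r • y (b, j) := by
    have := hy _ (Or.inl (Or.inl (Or.inr ⟨(r, b, j), rfl⟩)))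
    simp only [eqSMul, LinearMap.mem_affineFiber, LinearMap.sub_apply, LinearMap.smul_apply,
      hπ] at this
    exact sub_eq_zero.mp this
  refine ⟨fun j ↦
    { toFun := fun b ↦ y (b, j)
      map_add' := fun b b' ↦ hadd b b' j
      map_smul' := fun r b ↦ hsmul r b j }, fun j ↦ LinearMap.ext fun a ↦ ?_,
    fun i j hij ↦ LinearMap.ext fun b ↦ ?_⟩
  · exact hy _ (Or.inl (Or.inr ⟨(a, j), rfl⟩))
  · have := hy _ (Or.inr ⟨(b, ⟨(i, j), hij⟩), rfl⟩)
    simp only [eqCompat, LinearMap.mem_affineFiber, LinearMap.sub_apply, LinearMap.comp_apply,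
      hπ] at this
    exact sub_eq_zero.mp this

/-- In a complete module, a compatible family of linear maps to the quotients by open submodules
which form a basis of neighbourhoods of zero lifts to a linear map. -/
theorem IsAdicComplete.exists_mkQ_comp_eq {B J : Type*} [AddCommGroup B] [Module R B]
    (I : Ideal R) [IsAdicComplete I M] (Q : J → Submodule R M)
    (hQ : Directed (· ≥ ·) Q)
    (hopen : ∀ j, ∃ n : ℕ, I ^ n • (⊤ : Submodule R M) ≤ Q j)
    (hsmall : ∀ n : ℕ, ∃ j, Q j ≤ I ^ n • (⊤ : Submodule R M))
    (h : ∀ j, B →ₗ[R] M ⧸ Q j) (hc : ∀ i j (hij : Q i ≤ Q j), Submodule.factor hij ∘ₗ h i = h j) :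
    ∃ g : B →ₗ[R] M, ∀ j, (Q j).mkQ ∘ₗ g = h j := by
  choose q hq using hsmall
  have hc' (i j : J) (hij : Q i ≤ Q j) (b : B) (m : M) (hm : (Q i).mkQ m = h i b) :
      (Q j).mkQ m = h j b := by
    rw [← hc i j hij, LinearMap.comp_apply, ← hm]
    rfl
  have hpt (b : B) : ∃ z : M, ∀ j, (Q j).mkQ z = h j b := by
    choose m hm using fun j ↦ (Q j).mkQ_surjective (h j b)
    obtain ⟨z, hz⟩ := IsPrecomplete.prec (I := I) (M := M) inferInstance
      (f := fun n ↦ m (q n)) (by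
        intro k n hkn
        -- `Q (q k)` and `Q (q n)` need not be nested, so both representatives are compared with one
        -- at a common lower level.
        obtain ⟨l, hlk, hln⟩ := hQ (q k) (q n)
        have h1 := hc' _ _ hlk b (m l) (hm l)
        have h2 := hc' _ _ hln b (m l) (hm l)
        rw [← hm, Submodule.mkQ_apply, Submodule.mkQ_apply, Submodule.Quotient.eq] at h1 h2
        rw [SModEq.sub_mem]
        have h3 := sub_mem (Submodule.smul_mono_left (Ideal.pow_le_pow_right hkn) (hq n h2))
          (hq k h1)
        simpa using h3)
    refine ⟨z, fun j ↦ ?_⟩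
    obtain ⟨n, hn⟩ := hopen j
    rw [← hc' (q n) j ((hq n).trans hn) b _ (hm _), eq_comm, Submodule.mkQ_apply,
      Submodule.mkQ_apply, Submodule.Quotient.eq]
    exact hn (SModEq.sub_mem.mp (hz n))
  choose g hg using hpt
  -- The `Q j` intersect in zero, so the pointwise limits are unique and hence linear in `b`.
  have heq (x y : M) (hxy : ∀ j, (Q j).mkQ x = (Q j).mkQ y) : x = y := by
    rw [IsHausdorff.eq_iff_smodEq (I := I)]
    intro n
    have := hxy (q n)
    rw [Submodule.mkQ_apply, Submodule.mkQ_apply, Submodule.Quotient.eq] at this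
    exact SModEq.sub_mem.mpr (hq n this)
  exact ⟨{ toFun := g
           map_add' := fun x y ↦ heq _ _ fun j ↦ by rw [map_add, hg, hg, hg, map_add]
           map_smul' := fun r x ↦ heq _ _ fun j ↦ by
            rw [map_smul, hg, hg, map_smul, RingHom.id_apply] },
    fun j ↦ LinearMap.ext fun b ↦ hg b j⟩

end Gluing

theorem corollary5p9 (R : Type u) [CommRing R] [IsLocalRing R] [IsNoetherianRing R]
    [IsAdicComplete (IsLocalRing.maximalIdeal R) R]
    (M : Type v) [AddCommGroup M] [Module R M] [Module.Finite R M]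
    (hM : HasSmallCofiniteIrreducibles R M) :
    IsCPInjective.{u, v, w} R M := by
  intro A B C _ _ _ _ _ _ f g hfg
  refine ⟨LinearMap.lcomp_injective_of_surjective g hfg.surjective,
    LinearMap.exact_lcomp_of_exact_of_surjective M hfg.exact hfg.surjective, fun φ ↦ ?_⟩
  let J := {Q : Submodule R M // InfIrred Q ∧ IsArtinian R (M ⧸ Q)}
  let Q : J → Submodule R M := Subtype.val
  have (j : J) : IsArtinian R (M ⧸ Q j) := j.2.2
  have hopen (j : J) := (Q j).exists_maximalIdeal_pow_smul_top_le
  have hsmall (n : ℕ) : ∃ j : J, Q j ≤ IsLocalRing.maximalIdeal R ^ n • (⊤ : Submodule R M) := by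
    obtain ⟨P, hP, hPn, hPa⟩ := hM n
    exact ⟨⟨P, hP, hPa⟩, hPn⟩
  have : Nonempty J := (hsmall 0).nonempty
  -- An intersection of irreducibles need not be irreducible, but it contains some `𝔪 ^ k M` and so
  -- a small irreducible.
  have hdir : Directed (· ≥ ·) Q := by
    intro i j
    obtain ⟨m, hm⟩ := hopen i
    obtain ⟨n, hn⟩ := hopen j
    obtain ⟨k, hk⟩ := hsmall (max m n)
    exact ⟨k, hk.trans ((Submodule.smul_mono_left
      (Ideal.pow_le_pow_right (le_max_left m n))).trans hm), hk.trans ((Submodule.smul_mono_left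
      (Ideal.pow_le_pow_right (le_max_right m n))).trans hn)⟩
  -- Cyclic purity applies to the annihilator of `M ⧸ Q j`, which is finitely generated because `R`
  -- is Noetherian.
  obtain ⟨h, hext, hcompat⟩ := exists_compatible_family_of_exists_extension Q hdir f φ fun j ↦
    exists_comp_eq_of_infIrred_bot (Submodule.infIrred_bot_quotient j.2.1) f
      (hfg.lTensor_injective _ (IsNoetherian.noetherian _)) _
  have : IsPrecomplete (IsLocalRing.maximalIdeal R) M := IsPrecomplete.of_module_finite _ M
  have : IsAdicComplete (IsLocalRing.maximalIdeal R) M := {}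
  obtain ⟨ψ, hψ⟩ := IsAdicComplete.exists_mkQ_comp_eq (IsLocalRing.maximalIdeal R) Q hdir hopen
    hsmall h hcompat
  refine ⟨ψ, LinearMap.ext fun a ↦ ?_⟩
  -- `ψ ∘ f` and `φ` agree modulo every `Q j`, hence modulo every `𝔪 ^ n M`.
  rw [IsHausdorff.eq_iff_smodEq (I := IsLocalRing.maximalIdeal R)]
  intro n
  obtain ⟨j, hj⟩ := hsmall n
  have := LinearMap.congr_fun (hext j) a
  rw [← hψ j, LinearMap.comp_apply, LinearMap.comp_apply, LinearMap.comp_apply, Submodule.mkQ_apply,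
    Submodule.mkQ_apply, Submodule.Quotient.eq] at this
  exact SModEq.sub_mem.mpr (hj this)
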